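/- Let $n\ge 1$, $N=2^n$, and let $S\subseteq\{0,1\}^n$ be a nonempty set of $M$ marked strings with Hamming weights $n_1,\dots,n_M$, such that $|S_1\rangle=\frac1{\sqrt M}\sum_{x\in S}|x\rangle$ is symmetric, i.e. invariant under all permutations of the $n$ qubits. Let $|\psi_0\rangle=\frac1{\sqrt N}\sum_{x\in\{0,1\}^n}|x\rangle$, let $G=(2|\psi_0\rangle\langle\psi_0|-I)\,O_S$ be the Grover operation, where $O_S|x\rangle=-|x\rangle$ for $x\in S$ and $O_S|x\rangle=|x\rangle$ otherwise, and let $|\psi_{k,M}\rangle=G^k|\psi_0\rangle$ be the state after $k\ge 0$ iterations. Put $\theta_k=(2k+1)\arcsin\sqrt{M/N}$ and $$B_{\max}=\max_{\alpha\in[0,\pi]}\frac1{\sqrt M}\sum_{i=1}^M\cos^{n-n_i}\tfrac{\alpha}{2}\,\sin^{n_i}\tfrac{\alpha}{2}.$$ Then, for $N\gg M$, $$\max_{\phi}|\langle\psi_{k,M}|\phi\rangle|^2\simeq\max\left(\cos^2\theta_k,\ \sin^2\theta_k\,B_{\max}^2\right),$$ where the maximum is over all product states $|\phi\rangle=\bigotimes_{s=1}^n|\phi_s\rangle$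 of single-qubit pure states. That is, for every $\varepsilon>0$ there is a $\delta>0$, depending only on $\varepsilon$, such that for all $n$, $S$ and $k$ as above with $M\le\delta N$, the maximum on the left is attained and the two sides differ by at most $\varepsilon$. -/

import Mathlib

noncomputable section

namespace GroverGME

/-- The state space of `n` qubits, with computational basis indexed by bit strings of length `n`. -/
abbrev Qubits (n : ℕ) : Type := EuclideanSpace ℂ (Fin n → Fin 2)

/-- The computational basis state `|x⟩`. -/
def ket {n : ℕ} (x : Fin n → Fin 2) : Qubits n := EuclideanSpace.single x 1

/-- The uniform superposition `|ψ₀⟩` of all `N = 2 ^ n` basis states. -/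
def uniformState (n : ℕ) : Qubits n :=
  ((1 / √((2 : ℝ) ^ n) : ℝ) : ℂ) • ∑ x : Fin n → Fin 2, ket x

/-- The uniform superposition `|S₁⟩` of the marked basis states. -/
def markedState {n : ℕ} (S : Finset (Fin n → Fin 2)) : Qubits n :=
  ((1 / √(S.card : ℝ) : ℝ) : ℂ) • ∑ x ∈ S, ket x

/-- The oracle: it flips the sign of the amplitude of every marked basis state. -/
def oracle {n : ℕ} (S : Finset (Fin n → Fin 2)) (ψ : Qubits n) : Qubits n :=
  WithLp.toLp 2 fun x => if x ∈ S then -ψ x else ψ x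

/-- The diffusion operator `2|ψ₀⟩⟨ψ₀| - I` (inversion about the mean). -/
def diffusion {n : ℕ} (ψ : Qubits n) : Qubits n :=
  (2 * inner ℂ (uniformState n) ψ) • uniformState n - ψ

/-- The Grover operation `G`: one oracle call followed by the diffusion operator. -/
def groverOp {n : ℕ} (S : Finset (Fin n → Fin 2)) (ψ : Qubits n) : Qubits n :=
  diffusion (oracle S ψ)

/-- The state `|ψ_{k,M}⟩ = G ^ k |ψ₀⟩` after `k` Grover iterations. -/
def groverState {n : ℕ} (S : Finset (Fin n → Fin 2)) (k : ℕ) : Qubits n :=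
  (groverOp S)^[k] (uniformState n)

/-- The angle `θ_k = (2 k + 1) θ`, where `θ = arcsin √(M / N)`. -/
def groverAngle {n : ℕ} (S : Finset (Fin n → Fin 2)) (k : ℕ) : ℝ :=
  (2 * (k : ℝ) + 1) * Real.arcsin (√((S.card : ℝ) / (2 : ℝ) ^ n))

/-- The action of a permutation of the qubits on `n`-qubit states. -/
def permuteQubits {n : ℕ} (σ : Equiv.Perm (Fin n)) (ψ : Qubits n) : Qubits n :=
  WithLp.toLp 2 fun x => ψ (x ∘ σ)

/-- A state is symmetric if it is invariant under every permutation of the qubits. -/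
def IsSymmetricState {n : ℕ} (ψ : Qubits n) : Prop :=
  ∀ σ : Equiv.Perm (Fin n), permuteQubits σ ψ = ψ

/-- The tensor product of `n` single-qubit vectors. -/
def tensorState {n : ℕ} (v : Fin n → EuclideanSpace ℂ (Fin 2)) : Qubits n :=
  WithLp.toLp 2 fun x => ∏ s, v s (x s)

/-- Fully separable pure states: tensor products of `n` single-qubit pure (unit) states. -/
def IsProductState {n : ℕ} (φ : Qubits n) : Prop :=
  ∃ v : Fin n → EuclideanSpace ℂ (Fin 2), (∀ s, ‖v s‖ = 1) ∧ φ = tensorState v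

/-- The set of squared overlaps `|⟨ψ|φ⟩|²` of `ψ` with product states `φ`. -/
def squaredOverlaps {n : ℕ} (ψ : Qubits n) : Set ℝ :=
  {r | ∃ φ : Qubits n, IsProductState φ ∧ r = ‖(inner ℂ ψ φ : ℂ)‖ ^ 2}

/-- `B(α) = (1/√M) ∑ cos^(n-|x|) (α/2) sin^|x| (α/2)`, the sum over the marked strings `x`, where
`|x|` is the Hamming weight. -/
def overlapB {n : ℕ} (S : Finset (Fin n → Fin 2)) (α : ℝ) : ℝ :=
  1 / √(S.card : ℝ) *
    ∑ x ∈ S, Real.cos (α / 2) ^ (n - hammingNorm x) * Real.sin (α / 2) ^ hammingNorm x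

end GroverGME

end

/-! Grover iteration stays in the real plane spanned by `|ψ₀⟩` and `|S₁⟩`, and for `M/N` small these
two states are nearly orthogonal. So, for a product state with overlaps of moduli `a` and `b` with
them, `|⟨ψ_{k,M}|φ⟩|²` is close to `cos²θ_k a² + sin²θ_k b²`, provided the cross term, of order
`ab`, is small.

The crux is `norm_inner_uniformState_pow_mul_le`: every product state satisfies `a⁸ b⁴ ≤ M/N`,
uniformly in `n`. The bound factorises over the qubits, leaving a one-qubit inequality. As `ab` is
small, the weighted sum exceeds neither of its extremes `cos²θ_k` and `sin²θ_k Bmax²` by much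
(`convex_combination_le_max`).

Both extremes are nearly reached: `|ψ₀⟩` is itself a product state with `a = 1`, and the largest `b`
is `Bmax`. The latter uses symmetry: averaging the angles of two qubits never lowers the overlap
with `|S₁⟩`, so identical real factors are optimal (`exists_angleSum_le_const`). -/

namespace GroverGME

open Finset

variable {n : ℕ}

/-! ### Overlaps of the uniform and marked states -/

section Basic

lemma markedState_apply (S : Finset (Fin n → Fin 2)) (x : Fin n → Fin 2) :
    markedState S x = if x ∈ S then ((1 / √(S.card : ℝ) : ℝ) : ℂ) else 0 := by
  simp [markedState, ket]

lemma uniformState_eq_markedState (n : ℕ) :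
    uniformState n = markedState (univ : Finset (Fin n → Fin 2)) := by
  simp [uniformState, markedState]

lemma inner_markedState (S : Finset (Fin n → Fin 2)) (φ : Qubits n) :
    inner ℂ (markedState S) φ = ((1 / √(S.card : ℝ) : ℝ) : ℂ) * ∑ x ∈ S, φ x := by
  rw [PiLp.inner_apply]
  simp only [markedState_apply, RCLike.inner_apply, apply_ite (starRingEnd ℂ), Complex.conj_ofReal,
    map_zero, mul_ite, mul_zero, Finset.sum_ite_mem, Finset.univ_inter]
  rw [Finset.mul_sum]
  exact Finset.sum_congr rfl fun x _ => mul_comm _ _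

lemma inner_markedState_self {S : Finset (Fin n → Fin 2)} (hS : S.Nonempty) :
    inner ℂ (markedState S) (markedState S) = 1 := by
  have h : 0 < (S.card : ℝ) := by exact_mod_cast hS.card_pos
  rw [inner_markedState, Finset.sum_congr rfl fun x hx => by rw [markedState_apply, if_pos hx]]
  rw [Finset.sum_const, nsmul_eq_mul]
  have h2 : √(S.card : ℝ) ≠ 0 := (Real.sqrt_pos.2 h).ne'
  have h3 : √(S.card : ℝ) * √(S.card : ℝ) = S.card := Real.mul_self_sqrt h.le
  have : (1 / √(S.card : ℝ)) * ((S.card : ℝ) * (1 / √(S.card : ℝ))) = 1 := by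
    field_simp; rw [sq, h3]
  exact_mod_cast this

lemma norm_markedState {S : Finset (Fin n → Fin 2)} (hS : S.Nonempty) : ‖markedState S‖ = 1 := by
  have h := inner_self_eq_norm_sq_to_K (𝕜 := ℂ) (markedState S)
  rw [inner_markedState_self hS] at h
  have h1 : ‖markedState S‖ ^ 2 = 1 := by
    apply Complex.ofReal_injective
    simpa using h.symm
  exact (pow_eq_one_iff_of_nonneg (norm_nonneg _) two_ne_zero).1 h1

lemma inner_uniformState_self : inner ℂ (uniformState n) (uniformState n) = 1 := by
  rw [uniformState_eq_markedState, inner_markedState_self univ_nonempty]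

lemma inner_uniformState (φ : Qubits n) :
    inner ℂ (uniformState n) φ = ((1 / √((2 : ℝ) ^ n) : ℝ) : ℂ) * ∑ x, φ x := by
  rw [uniformState_eq_markedState, inner_markedState]
  simp

lemma inner_uniformState_markedState (S : Finset (Fin n → Fin 2)) :
    inner ℂ (uniformState n) (markedState S) = ((√((S.card : ℝ) / 2 ^ n) : ℝ) : ℂ) := by
  rw [inner_uniformState]
  simp only [markedState_apply, Finset.sum_ite_mem, Finset.univ_inter, Finset.sum_const,
    nsmul_eq_mul]
  have : 1 / √((2 : ℝ) ^ n) * ((S.card : ℝ) * (1 / √(S.card : ℝ))) = √((S.card : ℝ) / 2 ^ n) := by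
    rw [Real.sqrt_div (Nat.cast_nonneg _), mul_one_div, Real.div_sqrt]; ring
  exact_mod_cast this

end Basic

/-! ### Grover dynamics in the plane of `|ψ₀⟩` and `|S₁⟩` -/

section Iteration

lemma oracle_uniformState (S : Finset (Fin n → Fin 2)) :
    oracle S (uniformState n) = uniformState n
      - ((2 * √((S.card : ℝ) / 2 ^ n) : ℝ) : ℂ) • markedState S := by
  ext x
  have hx : uniformState n x = ((1 / √((2 : ℝ) ^ n) : ℝ) : ℂ) := by
    rw [uniformState_eq_markedState, markedState_apply]; simp
  simp only [oracle, PiLp.sub_apply, PiLp.smul_apply, markedState_apply, hx, smul_eq_mul]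
  split_ifs with h
  · have hc : 0 < (S.card : ℝ) := by exact_mod_cast Finset.card_pos.2 ⟨x, h⟩
    have h2 : √(S.card : ℝ) ≠ 0 := (Real.sqrt_pos.2 hc).ne'
    have : -(1 / √((2 : ℝ) ^ n)) = 1 / √((2 : ℝ) ^ n)
        - 2 * √((S.card : ℝ) / 2 ^ n) * (1 / √(S.card : ℝ)) := by
      rw [Real.sqrt_div hc.le]; field_simp; norm_num
    exact_mod_cast this
  · simp

lemma oracle_markedState (S : Finset (Fin n → Fin 2)) :
    oracle S (markedState S) = -markedState S := by
  ext x
  simp only [oracle, PiLp.neg_apply, markedState_apply]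
  split_ifs <;> simp

lemma oracle_add_smul (S : Finset (Fin n → Fin 2)) (u v : Qubits n) (a b : ℂ) :
    oracle S (a • u + b • v) = a • oracle S u + b • oracle S v := by
  ext x
  simp only [oracle, PiLp.add_apply, PiLp.smul_apply, smul_eq_mul]
  split_ifs <;> ring

lemma groverOp_combination (S : Finset (Fin n → Fin 2)) (a b : ℝ) :
    groverOp S ((a : ℂ) • uniformState n + (b : ℂ) • markedState S) =
      ((a - 2 * √((S.card : ℝ) / 2 ^ n) * (2 * √((S.card : ℝ) / 2 ^ n) * a + b) : ℝ) : ℂ)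
        • uniformState n
      + ((2 * √((S.card : ℝ) / 2 ^ n) * a + b : ℝ) : ℂ) • markedState S := by
  rw [groverOp, oracle_add_smul, oracle_uniformState, oracle_markedState, diffusion]
  simp only [inner_add_right, inner_sub_right, inner_smul_right, inner_neg_right,
    inner_uniformState_self, inner_uniformState_markedState]
  push_cast
  module

/-- This is the rotation `cos θ_k |S₀⟩ + sin θ_k |S₁⟩`, where the unit vector `|S₀⟩ = (|ψ₀⟩ - sin θ
|S₁⟩) / cos θ` is orthogonal to `|S₁⟩`. Each iteration adds `2θ` to the angle; `M < N` keeps `cos θ`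
positive. -/
lemma groverState_eq {S : Finset (Fin n → Fin 2)} (hS : (S.card : ℝ) < 2 ^ n) (k : ℕ) :
    groverState S k =
      ((Real.cos (groverAngle S k) / Real.cos (Real.arcsin √((S.card : ℝ) / 2 ^ n)) : ℝ) : ℂ)
        • uniformState n
      + ((Real.sin (groverAngle S k) - Real.cos (groverAngle S k) * √((S.card : ℝ) / 2 ^ n) /
          Real.cos (Real.arcsin √((S.card : ℝ) / 2 ^ n)) : ℝ) : ℂ) • markedState S := by
  have h1 : (S.card : ℝ) / 2 ^ n < 1 := (div_lt_one (by positivity)).2 hS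
  have h0 : 0 ≤ √((S.card : ℝ) / 2 ^ n) := Real.sqrt_nonneg _
  have h2 : √((S.card : ℝ) / 2 ^ n) < 1 := by
    rw [Real.sqrt_lt' one_pos]; simpa using h1
  have hsin : Real.sin (Real.arcsin √((S.card : ℝ) / 2 ^ n)) = √((S.card : ℝ) / 2 ^ n) :=
    Real.sin_arcsin (by linarith) h2.le
  have hcos : 0 < Real.cos (Real.arcsin √((S.card : ℝ) / 2 ^ n)) := by
    rw [Real.cos_arcsin]; apply Real.sqrt_pos.2; nlinarith
  induction k with
  | zero =>
    have hA : groverAngle S 0 = Real.arcsin √((S.card : ℝ) / 2 ^ n) := by simp [groverAngle]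
    rw [hA, hsin, div_self hcos.ne', mul_div_assoc, mul_comm, div_mul_cancel₀ _ hcos.ne']
    simp [groverState]
  | succ k ih =>
    have hA : groverAngle S (k + 1) =
        groverAngle S k + 2 * Real.arcsin √((S.card : ℝ) / 2 ^ n) := by
      simp only [groverAngle]; push_cast; ring
    have hstep : groverState S (k + 1) = groverOp S (groverState S k) := by
      simp only [groverState, Function.iterate_succ_apply']
    rw [hstep, ih, groverOp_combination, hA, Real.cos_add, Real.sin_add, Real.sin_two_mul,
      Real.cos_two_mul, hsin]
    have hC : Real.cos (Real.arcsin √((S.card : ℝ) / 2 ^ n)) ^ 2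
        = 1 - √((S.card : ℝ) / 2 ^ n) ^ 2 := by
      rw [← hsin, ← Real.sin_sq_add_cos_sq (Real.arcsin √((S.card : ℝ) / 2 ^ n)), hsin]; ring
    generalize Real.cos (Real.arcsin √((S.card : ℝ) / 2 ^ n)) = C at *
    generalize √((S.card : ℝ) / 2 ^ n) = σ at *
    have hσ : σ ^ 2 = 1 - C ^ 2 := by linarith
    congr 3
    · field_simp
      ring_nf
      simp only [hσ]
      ring
    · field_simp
      ring_nf
      simp only [hσ]
      ring

end Iteration

/-! ### Product states and the trade-off between the two overlaps -/

section Products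

lemma sum_prod_qubits {R : Type*} [CommSemiring R] (f : Fin n → Fin 2 → R) :
    ∑ x : Fin n → Fin 2, ∏ s, f s (x s) = ∏ s, (f s 0 + f s 1) := by
  simpa [Fin.sum_univ_two] using (Finset.prod_univ_sum (fun _ => univ) f).symm

lemma norm_sq_qubit (v : EuclideanSpace ℂ (Fin 2)) : ‖v‖ ^ 2 = ‖v 0‖ ^ 2 + ‖v 1‖ ^ 2 := by
  simp [EuclideanSpace.norm_sq_eq]

lemma norm_tensorState {v : Fin n → EuclideanSpace ℂ (Fin 2)} (hv : ∀ s, ‖v s‖ = 1) :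
    ‖tensorState v‖ = 1 := by
  have h : ‖tensorState v‖ ^ 2 = 1 := by
    simp only [EuclideanSpace.norm_sq_eq, tensorState, norm_prod, ← Finset.prod_pow]
    rw [sum_prod_qubits fun s i => ‖v s i‖ ^ 2]
    simp [← norm_sq_qubit, hv]
  exact (pow_eq_one_iff_of_nonneg (norm_nonneg _) two_ne_zero).1 h

lemma norm_inner_markedState_le_one {S : Finset (Fin n → Fin 2)} (hS : S.Nonempty)
    {v : Fin n → EuclideanSpace ℂ (Fin 2)} (hv : ∀ s, ‖v s‖ = 1) :
    ‖(inner ℂ (markedState S) (tensorState v) : ℂ)‖ ≤ 1 := by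
  simpa [norm_markedState hS, norm_tensorState hv] using
    norm_inner_le_norm (𝕜 := ℂ) (markedState S) (tensorState v)

/-- With `u = 2pq` the left side is `(1 + u)⁴ (1 - u²/2)`. The exponents 8 and 4 make `u = 1`, that
is `p = q`, a critical point, whence the factor `(1 - u)²` in the deficit. -/
lemma qubit_overlap_mul_le {p q : ℝ} (h : p ^ 2 + q ^ 2 = 1) (hp : 0 ≤ p) (hq : 0 ≤ q) :
    (p + q) ^ 8 * (p ^ 4 + q ^ 4) ≤ 8 := by
  have h0 : 0 ≤ p * q := mul_nonneg hp hq
  have h1 : 2 * (p * q) ≤ 1 := by nlinarith [sq_nonneg (p - q)]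
  have e1 : (p + q) ^ 8 = (1 + 2 * (p * q)) ^ 4 := by
    rw [← h]; ring
  have e2 : p ^ 4 + q ^ 4 = 1 - (2 * (p * q)) ^ 2 / 2 := by
    have : p ^ 4 + q ^ 4 = (p ^ 2 + q ^ 2) ^ 2 - 2 * (p * q) ^ 2 := by ring
    rw [this, h]; ring
  rw [e1, e2]
  set u := 2 * (p * q)
  have hu : 0 ≤ u := by positivity
  have key : 8 - (1 + u) ^ 4 * (1 - u ^ 2 / 2)
      = (1 - u) ^ 2 * (14 + 20 * u + 15 * u ^ 2 + 6 * u ^ 3 + u ^ 4) / 2 := by ring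
  have : 0 ≤ (1 - u) ^ 2 * (14 + 20 * u + 15 * u ^ 2 + 6 * u ^ 3 + u ^ 4) / 2 := by positivity
  linarith

lemma norm_inner_uniformState_tensorState (v : Fin n → EuclideanSpace ℂ (Fin 2)) :
    ‖(inner ℂ (uniformState n) (tensorState v) : ℂ)‖ = 1 / √((2 : ℝ) ^ n) * ∏ s, ‖v s 0 + v s 1‖ := by
  rw [inner_uniformState]
  simp only [tensorState]
  rw [sum_prod_qubits fun s i => v s i, norm_mul, norm_prod, Complex.norm_real,
    Real.norm_of_nonneg (by positivity)]

lemma norm_inner_markedState_tensorState_le (S : Finset (Fin n → Fin 2))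
    (v : Fin n → EuclideanSpace ℂ (Fin 2)) :
    ‖(inner ℂ (markedState S) (tensorState v) : ℂ)‖
      ≤ 1 / √(S.card : ℝ) * ∑ x ∈ S, ∏ s, ‖v s (x s)‖ := by
  rw [inner_markedState, norm_mul, Complex.norm_real, Real.norm_of_nonneg (by positivity)]
  gcongr
  refine (norm_sum_le _ _).trans (Finset.sum_le_sum fun x _ => ?_)
  simp [tensorState, norm_prod]

/-- A product state cannot have a large overlap both with the uniform superposition and with the
superposition of a small fraction of the basis states. -/
lemma norm_inner_uniformState_pow_mul_le {S : Finset (Fin n → Fin 2)} (hS : S.Nonempty)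
    {v : Fin n → EuclideanSpace ℂ (Fin 2)} (hv : ∀ s, ‖v s‖ = 1) :
    ‖(inner ℂ (uniformState n) (tensorState v) : ℂ)‖ ^ 8 *
      ‖(inner ℂ (markedState S) (tensorState v) : ℂ)‖ ^ 4 ≤ (S.card : ℝ) / 2 ^ n := by
  have hc : 0 < (S.card : ℝ) := by exact_mod_cast hS.card_pos
  -- The power mean inequality with exponent 4 gains the factor `M`; squares would only give `b ≤
  -- 1`. Extending the sum to all strings makes it factorise.
  have hpow : ‖(inner ℂ (markedState S) (tensorState v) : ℂ)‖ ^ 4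
      ≤ S.card * ∏ s, (‖v s 0‖ ^ 4 + ‖v s 1‖ ^ 4) := by
    have h2 : (∑ x ∈ S, ∏ s, ‖v s (x s)‖) ^ 4 / (S.card : ℝ) ^ 3
        ≤ ∑ x ∈ S, (∏ s, ‖v s (x s)‖) ^ 4 :=
      pow_sum_div_card_le_sum_pow (n := 3) fun x _ => by positivity
    have h3 : ∑ x ∈ S, (∏ s, ‖v s (x s)‖) ^ 4 ≤ ∏ s, (‖v s 0‖ ^ 4 + ‖v s 1‖ ^ 4) := by
      rw [← sum_prod_qubits fun s i => ‖v s i‖ ^ 4]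
      simp only [Finset.prod_pow]
      exact Finset.sum_le_sum_of_subset_of_nonneg (Finset.subset_univ _)
        fun x _ _ => by positivity
    have h4 : (√(S.card : ℝ)) ^ 4 = (S.card : ℝ) ^ 2 := by
      rw [show 4 = 2 * 2 by rfl, pow_mul, Real.sq_sqrt hc.le]
    calc _ ≤ (1 / √(S.card : ℝ) * ∑ x ∈ S, ∏ s, ‖v s (x s)‖) ^ 4 := by
          gcongr; exact norm_inner_markedState_tensorState_le S v
      _ = S.card * ((∑ x ∈ S, ∏ s, ‖v s (x s)‖) ^ 4 / (S.card : ℝ) ^ 3) := by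
          rw [mul_pow, div_pow, h4]; field_simp
      _ ≤ _ := by gcongr; exact h2.trans h3
  have hunif : ‖(inner ℂ (uniformState n) (tensorState v) : ℂ)‖ ^ 8
      ≤ (∏ s, (‖v s 0‖ + ‖v s 1‖) ^ 8) / 16 ^ n := by
    have h16 : (√((2 : ℝ) ^ n)) ^ 8 = 16 ^ n := by
      rw [show 8 = 2 * 4 by rfl, pow_mul, Real.sq_sqrt (by positivity), ← pow_mul, mul_comm,
        pow_mul]; norm_num
    rw [norm_inner_uniformState_tensorState, mul_pow, div_pow, h16, Finset.prod_pow, one_pow,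
      one_div_mul_eq_div]
    gcongr with s
    exact norm_add_le _ _
  calc _ ≤ ((∏ s, (‖v s 0‖ + ‖v s 1‖) ^ 8) / 16 ^ n) *
        (S.card * ∏ s, (‖v s 0‖ ^ 4 + ‖v s 1‖ ^ 4)) := by gcongr
    _ = (S.card : ℝ) / 16 ^ n *
        ∏ s, ((‖v s 0‖ + ‖v s 1‖) ^ 8 * (‖v s 0‖ ^ 4 + ‖v s 1‖ ^ 4)) := by
      rw [Finset.prod_mul_distrib]; ring
    _ ≤ (S.card : ℝ) / 16 ^ n * ∏ s : Fin n, 8 := by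
      gcongr with s
      exact qubit_overlap_mul_le (by rw [← norm_sq_qubit, hv, one_pow]) (norm_nonneg _)
        (norm_nonneg _)
    _ = (S.card : ℝ) / 2 ^ n := by
      rw [Finset.prod_const, Finset.card_univ, Fintype.card_fin,
        show (16 : ℝ) ^ n = 2 ^ n * 8 ^ n by rw [← mul_pow]; norm_num]
      field_simp

end Products

/-! ### Symmetric marked sets: identical factors are optimal -/

section SymmetricMaximum

/-- The amplitudes of the real single-qubit state `cos t |0⟩ + sin t |1⟩`. -/
noncomputable def angleAmplitude (t : ℝ) (b : Fin 2) : ℝ := if b = 0 then Real.cos t else Real.sin t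

/-- The sum over `S` of the amplitudes of the product of the states `cos t |0⟩ + sin t |1⟩`. -/
noncomputable def angleSum (S : Finset (Fin n → Fin 2)) (t : Fin n → ℝ) : ℝ :=
  ∑ x ∈ S, ∏ s, angleAmplitude (t s) (x s)

lemma angleAmplitude_nonneg {t : ℝ} (ht : t ∈ Set.Icc 0 (Real.pi / 2)) (b : Fin 2) :
    0 ≤ angleAmplitude t b := by
  unfold angleAmplitude
  split_ifs
  · exact Real.cos_nonneg_of_mem_Icc ⟨by linarith [ht.1, Real.pi_pos], ht.2⟩
  · exact Real.sin_nonneg_of_nonneg_of_le_pi ht.1 (by linarith [ht.2, Real.pi_pos])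

lemma continuous_angleSum (S : Finset (Fin n → Fin 2)) : Continuous (angleSum S) := by
  unfold angleSum angleAmplitude
  refine continuous_finsetSum _ fun x _ => continuous_finsetProd _ fun s _ => ?_
  split_ifs <;> fun_prop

/-- For `t = m + d` and `u = m - d`, equal bits lose `2 sin² d`, while for different bits both sides
equal `sin 2m`. -/
lemma angleAmplitude_add_swap_le (t u : ℝ) (a b : Fin 2) :
    angleAmplitude t a * angleAmplitude u b + angleAmplitude t b * angleAmplitude u a
      ≤ 2 * (angleAmplitude ((t + u) / 2) a * angleAmplitude ((t + u) / 2) b) := by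
  obtain ⟨m, d, rfl, rfl⟩ : ∃ m d, t = m + d ∧ u = m - d :=
    ⟨(t + u) / 2, (t - u) / 2, by ring, by ring⟩
  rw [show (m + d + (m - d)) / 2 = m by ring]
  have h1 := Real.sin_sq_add_cos_sq m
  have h2 := Real.sin_sq_add_cos_sq d
  have hd : 0 ≤ Real.sin d ^ 2 := sq_nonneg _
  unfold angleAmplitude
  fin_cases a <;> fin_cases b <;>
    simp [Real.cos_add, Real.cos_sub, Real.sin_add, Real.sin_sub]
  · nlinarith
  · linear_combination 2 * Real.sin m * Real.cos m * h2
  · linear_combination 2 * Real.sin m * Real.cos m * h2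
  · nlinarith

lemma prod_split {ι R : Type*} [Fintype ι] [DecidableEq ι] [CommMonoid R] (f : ι → R) {i j : ι}
    (hij : i ≠ j) : ∏ s, f s = f i * f j * ∏ s ∈ (univ.erase i).erase j, f s := by
  rw [← Finset.mul_prod_erase univ f (mem_univ i),
    ← Finset.mul_prod_erase (univ.erase i) f (by simp [hij.symm] : j ∈ univ.erase i), mul_assoc]

lemma angleSum_le_average {S : Finset (Fin n → Fin 2)}
    (hS : ∀ (σ : Equiv.Perm (Fin n)) x, x ∘ σ ∈ S ↔ x ∈ S) {t : Fin n → ℝ}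
    (ht : ∀ s, t s ∈ Set.Icc 0 (Real.pi / 2)) {i j : Fin n} (hij : i ≠ j) :
    angleSum S t ≤
      angleSum S (Function.update (Function.update t i ((t i + t j) / 2)) j ((t i + t j) / 2)) := by
  set t' := Function.update (Function.update t i ((t i + t j) / 2)) j ((t i + t j) / 2)
  have ti : t' i = (t i + t j) / 2 := by simp [t', hij]
  have tj : t' j = (t i + t j) / 2 := by simp [t']
  have ts : ∀ s ∈ (univ.erase i).erase j, t' s = t s := fun s hs => by
    simp only [Finset.mem_erase] at hs
    simp [t', hs.1, hs.2.1]
  -- Invariance of `S` allows each string to be paired with its swap, so that the two-qubit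
  -- inequality applies term by term.
  have hswap : angleSum S t = ∑ x ∈ S, ∏ s, angleAmplitude (t s) (x (Equiv.swap i j s)) := by
    unfold angleSum
    refine (Finset.sum_equiv ((Equiv.swap i j).arrowCongr (Equiv.refl (Fin 2))) ?_ ?_).symm
    · intro x
      exact (hS (Equiv.swap i j) x).symm
    · intro x _
      rfl
  suffices h : 2 * angleSum S t ≤ 2 * angleSum S t' by linarith
  calc 2 * angleSum S t
      = ∑ x ∈ S, (∏ s, angleAmplitude (t s) (x s)
          + ∏ s, angleAmplitude (t s) (x (Equiv.swap i j s))) := by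
        rw [Finset.sum_add_distrib, ← hswap, two_mul]; rfl
    _ ≤ ∑ x ∈ S, 2 * ∏ s, angleAmplitude (t' s) (x s) := by
        refine Finset.sum_le_sum fun x _ => ?_
        rw [prod_split _ hij, prod_split (fun s => angleAmplitude (t s) (x (Equiv.swap i j s))) hij,
          prod_split (fun s => angleAmplitude (t' s) (x s)) hij]
        have e1 : ∏ s ∈ (univ.erase i).erase j, angleAmplitude (t s) (x (Equiv.swap i j s))
            = ∏ s ∈ (univ.erase i).erase j, angleAmplitude (t s) (x s) :=
          Finset.prod_congr rfl fun s hs => by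
            simp only [Finset.mem_erase] at hs
            rw [Equiv.swap_apply_of_ne_of_ne hs.2.1 hs.1]
        have e2 : ∏ s ∈ (univ.erase i).erase j, angleAmplitude (t' s) (x s)
            = ∏ s ∈ (univ.erase i).erase j, angleAmplitude (t s) (x s) :=
          Finset.prod_congr rfl fun s hs => by rw [ts s hs]
        rw [e1, e2, ti, tj, Equiv.swap_apply_left, Equiv.swap_apply_right, ← add_mul, ← mul_assoc]
        exact mul_le_mul_of_nonneg_right (angleAmplitude_add_swap_le _ _ _ _)
          (Finset.prod_nonneg fun s _ => angleAmplitude_nonneg (ht s) _)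
    _ = 2 * angleSum S t' := by rw [← Finset.mul_sum]; rfl

lemma sum_sq_average_lt {t : Fin n → ℝ} {i j : Fin n} (hij : t i ≠ t j) :
    ∑ s, (Function.update (Function.update t i ((t i + t j) / 2)) j ((t i + t j) / 2)) s ^ 2
      < ∑ s, t s ^ 2 := by
  have hne : i ≠ j := fun h => hij (by rw [h])
  have h1 : ∀ (f : Fin n → ℝ), ∑ s, f s ^ 2
      = f i ^ 2 + f j ^ 2 + ∑ s ∈ (univ.erase i).erase j, f s ^ 2 := fun f => by
    rw [← Finset.add_sum_erase univ _ (mem_univ i),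
      ← Finset.add_sum_erase (univ.erase i) _ (by simp [hne.symm] : j ∈ univ.erase i), add_assoc]
  rw [h1, h1 t]
  have h2 : ∑ s ∈ (univ.erase i).erase j,
      (Function.update (Function.update t i ((t i + t j) / 2)) j ((t i + t j) / 2)) s ^ 2
      = ∑ s ∈ (univ.erase i).erase j, t s ^ 2 := Finset.sum_congr rfl fun s hs => by
    simp only [Finset.mem_erase] at hs
    simp [hs.1, hs.2.1]
  rw [h2]
  simp only [Function.update_self, Function.update_of_ne hne]
  nlinarith [sq_pos_of_ne_zero (sub_ne_zero.2 hij)]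

/-- For a permutation-invariant set of bit strings, the sum of the amplitudes of a product state
with nonnegative amplitudes is maximised by identical factors. -/
lemma exists_angleSum_le_const {S : Finset (Fin n → Fin 2)}
    (hS : ∀ (σ : Equiv.Perm (Fin n)) x, x ∘ σ ∈ S ↔ x ∈ S) :
    ∃ c ∈ Set.Icc 0 (Real.pi / 2), ∀ t : Fin n → ℝ, (∀ s, t s ∈ Set.Icc 0 (Real.pi / 2)) →
      angleSum S t ≤ angleSum S fun _ => c := by
  have hpi : 0 ≤ Real.pi / 2 := by positivity
  have hK : IsCompact (Set.univ.pi fun _ : Fin n => Set.Icc 0 (Real.pi / 2)) :=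
    isCompact_univ_pi fun _ => isCompact_Icc
  obtain ⟨t₀, ht₀, hmax⟩ := hK.exists_isMaxOn ⟨fun _ => 0, fun _ _ => ⟨le_rfl, hpi⟩⟩
    (continuous_angleSum S).continuousOn
  -- Among all maximisers, take one with the least sum of squared angles. Averaging two different
  -- angles would keep it a maximiser and strictly lower that sum, so all its angles agree.
  have hL : IsCompact ((Set.univ.pi fun _ : Fin n => Set.Icc 0 (Real.pi / 2)) ∩
      {t | angleSum S t₀ ≤ angleSum S t}) :=
    hK.inter_right (isClosed_le continuous_const (continuous_angleSum S))
  obtain ⟨t, ⟨ht, htm⟩, hmin⟩ := hL.exists_isMinOn ⟨t₀, ht₀, le_refl (angleSum S t₀)⟩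
    (f := fun t => ∑ s, t s ^ 2) (by fun_prop)
  have hconst : ∀ i j, t i = t j := by
    intro i j
    by_contra hij
    have hne : i ≠ j := fun h => hij (by rw [h])
    have hm : (t i + t j) / 2 ∈ Set.Icc 0 (Real.pi / 2) := by
      have hi := ht i trivial
      have hj := ht j trivial
      constructor <;> linarith [hi.1, hi.2, hj.1, hj.2]
    refine (sum_sq_average_lt hij).not_ge (hmin ⟨fun s _ => ?_, ?_⟩)
    · by_cases h1 : s = j
      · subst h1; simpa using hm
      · by_cases h2 : s = i
        · subst h2; simpa [h1] using hm
        · simpa [h1, h2] using ht s trivial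
    · exact le_trans htm (angleSum_le_average hS (fun s => ht s trivial) hne)
  obtain ⟨c, hc, htc⟩ : ∃ c ∈ Set.Icc 0 (Real.pi / 2), t = fun _ => c := by
    rcases isEmpty_or_nonempty (Fin n) with h | ⟨⟨i⟩⟩
    · exact ⟨0, ⟨le_rfl, hpi⟩, Subsingleton.elim _ _⟩
    · exact ⟨t i, ht i trivial, funext fun s => hconst s i⟩
  exact ⟨c, hc, fun u hu => htc ▸ le_trans (hmax fun s _ => hu s) htm⟩

lemma angleSum_const (S : Finset (Fin n → Fin 2)) (c : ℝ) :
    angleSum S (fun _ => c) = ∑ x ∈ S,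
      Real.cos c ^ (n - hammingNorm x) * Real.sin c ^ hammingNorm x := by
  unfold angleSum angleAmplitude
  refine Finset.sum_congr rfl fun x _ => ?_
  rw [Finset.prod_ite, Finset.prod_const, Finset.prod_const]
  have h := Finset.card_filter_add_card_filter_not (s := (univ : Finset (Fin n))) (fun s => x s = 0)
  have h2 : #{s | ¬ x s = 0} = hammingNorm x := rfl
  rw [Finset.card_univ, Fintype.card_fin, h2] at h
  rw [h2, Nat.eq_sub_of_add_eq h]

lemma overlapB_eq (S : Finset (Fin n → Fin 2)) (α : ℝ) :
    overlapB S α = 1 / √(S.card : ℝ) * angleSum S fun _ => α / 2 := by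
  rw [overlapB, angleSum_const]

lemma comp_perm_mem_iff {S : Finset (Fin n → Fin 2)} (hne : S.Nonempty)
    (hS : IsSymmetricState (markedState S)) (σ : Equiv.Perm (Fin n)) (x : Fin n → Fin 2) :
    x ∘ σ ∈ S ↔ x ∈ S := by
  have hc : 0 < (S.card : ℝ) := by exact_mod_cast hne.card_pos
  have h2 : √(S.card : ℝ) ≠ 0 := (Real.sqrt_pos.2 hc).ne'
  have h : markedState S (x ∘ σ) = markedState S x := congrArg (fun ψ : Qubits n => ψ x) (hS σ)
  rw [markedState_apply, markedState_apply] at h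
  have h3 : ((1 / √(S.card : ℝ) : ℝ) : ℂ) ≠ 0 := by exact_mod_cast one_div_ne_zero h2
  split_ifs at h with hx hy hy
  · exact iff_of_true hx hy
  · exact absurd h h3
  · exact absurd h.symm h3
  · exact iff_of_false hx hy

lemma exists_angle {p q : ℝ} (hp : 0 ≤ p) (hq : 0 ≤ q) (h : p ^ 2 + q ^ 2 = 1) :
    ∃ t ∈ Set.Icc 0 (Real.pi / 2), p = Real.cos t ∧ q = Real.sin t := by
  refine ⟨Real.arccos p, ⟨Real.arccos_nonneg _, Real.arccos_le_pi_div_two.2 hp⟩, ?_, ?_⟩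
  · rw [Real.cos_arccos] <;> nlinarith
  · rw [Real.sin_arccos, ← h, add_sub_cancel_left, Real.sqrt_sq hq]

/-- The overlap of a permutation-invariant marked state with a product state is at most the
maximum of `overlapB`. -/
lemma norm_inner_markedState_le {S : Finset (Fin n → Fin 2)} (hne : S.Nonempty)
    (hS : IsSymmetricState (markedState S)) {B : ℝ}
    (hB : B ∈ upperBounds (overlapB S '' Set.Icc 0 Real.pi))
    {v : Fin n → EuclideanSpace ℂ (Fin 2)} (hv : ∀ s, ‖v s‖ = 1) :
    ‖(inner ℂ (markedState S) (tensorState v) : ℂ)‖ ≤ B := by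
  obtain ⟨c, hc, hmax⟩ := exists_angleSum_le_const (comp_perm_mem_iff hne hS)
  choose t ht htc hts using fun s => exists_angle (norm_nonneg (v s 0)) (norm_nonneg (v s 1))
    (by rw [← norm_sq_qubit, hv, one_pow])
  have hsum : ∑ x ∈ S, ∏ s, ‖v s (x s)‖ = angleSum S t := by
    refine Finset.sum_congr rfl fun x _ => Finset.prod_congr rfl fun s _ => ?_
    unfold angleAmplitude
    split_ifs with h
    · rw [h, htc]
    · rw [Fin.eq_one_of_ne_zero _ h, hts]
  calc _ ≤ 1 / √(S.card : ℝ) * ∑ x ∈ S, ∏ s, ‖v s (x s)‖ :=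
        norm_inner_markedState_tensorState_le S v
    _ ≤ 1 / √(S.card : ℝ) * angleSum S fun _ => c := by
        rw [hsum]; gcongr; exact hmax t ht
    _ = overlapB S (2 * c) := by rw [overlapB_eq, mul_div_cancel_left₀ _ two_ne_zero]
    _ ≤ B := hB ⟨2 * c, ⟨by linarith [hc.1], by linarith [hc.2]⟩, rfl⟩

lemma exists_isGreatest_overlapB (S : Finset (Fin n → Fin 2)) :
    ∃ B, IsGreatest (overlapB S '' Set.Icc 0 Real.pi) B := by
  have hcont : Continuous (overlapB S) := by unfold overlapB; fun_prop
  exact (isCompact_Icc.image hcont).exists_isGreatest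
    ((Set.nonempty_Icc.2 Real.pi_pos.le).image _)

lemma exists_inner_markedState_eq_overlapB (S : Finset (Fin n → Fin 2)) (α : ℝ) :
    ∃ v : Fin n → EuclideanSpace ℂ (Fin 2), (∀ s, ‖v s‖ = 1) ∧
      ‖(inner ℂ (markedState S) (tensorState v) : ℂ)‖ = |overlapB S α| := by
  refine ⟨fun _ => WithLp.toLp 2 fun b => (angleAmplitude (α / 2) b : ℂ), fun s => ?_, ?_⟩
  · refine (pow_eq_one_iff_of_nonneg (norm_nonneg _) two_ne_zero).1 ?_
    rw [norm_sq_qubit]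
    simp [angleAmplitude, -Complex.ofReal_cos, -Complex.ofReal_sin]
  · rw [inner_markedState, overlapB_eq, ← Real.norm_eq_abs, ← Complex.norm_real]
    simp [tensorState, angleSum]

lemma exists_inner_uniformState_eq_one (n : ℕ) :
    ∃ v : Fin n → EuclideanSpace ℂ (Fin 2), (∀ s, ‖v s‖ = 1) ∧
      ‖(inner ℂ (uniformState n) (tensorState v) : ℂ)‖ = 1 := by
  refine ⟨fun _ => WithLp.toLp 2 fun _ => ((1 / √2 : ℝ) : ℂ), fun s => ?_, ?_⟩
  · refine (pow_eq_one_iff_of_nonneg (norm_nonneg _) two_ne_zero).1 ?_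
    rw [norm_sq_qubit]
    simp only [Complex.norm_real, Real.norm_eq_abs, sq_abs, div_pow, Real.sq_sqrt zero_le_two]
    norm_num
  · rw [norm_inner_uniformState_tensorState]
    have h : ‖((1 / √2 : ℝ) : ℂ) + ((1 / √2 : ℝ) : ℂ)‖ = √2 := by
      rw [← Complex.ofReal_add, Complex.norm_real, Real.norm_of_nonneg (by positivity),
        ← two_mul, mul_one_div, Real.div_sqrt]
    rw [h, Finset.prod_const, Finset.card_univ, Fintype.card_fin,
      Real.sqrt_eq_rpow, Real.sqrt_eq_rpow, ← Real.rpow_natCast, ← Real.rpow_natCast,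
      ← Real.rpow_mul zero_le_two, ← Real.rpow_mul zero_le_two, mul_comm (1 / 2 : ℝ)]
    exact one_div_mul_cancel (by positivity)

end SymmetricMaximum

/-! ### Attainment of the maximal overlap -/

section Compactness

lemma exists_isGreatest_squaredOverlaps (ψ : Qubits n) :
    ∃ m, IsGreatest (squaredOverlaps ψ) m := by
  have hset : squaredOverlaps ψ = (fun v => ‖(inner ℂ ψ (tensorState v) : ℂ)‖ ^ 2) ''
      (Set.univ.pi fun _ : Fin n => Metric.sphere (0 : EuclideanSpace ℂ (Fin 2)) 1) := by
    ext r
    constructor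
    · rintro ⟨φ, ⟨v, hv, rfl⟩, rfl⟩
      exact ⟨v, fun s _ => by simpa using hv s, rfl⟩
    · rintro ⟨v, hv, rfl⟩
      exact ⟨_, ⟨v, fun s => by simpa using hv s trivial, rfl⟩, rfl⟩
  have hcont : Continuous fun v : Fin n → EuclideanSpace ℂ (Fin 2) =>
      ‖(inner ℂ ψ (tensorState v) : ℂ)‖ ^ 2 := by
    have : Continuous fun v : Fin n → EuclideanSpace ℂ (Fin 2) => tensorState v := by
      unfold tensorState; fun_prop
    fun_prop
  rw [hset]
  refine ((isCompact_univ_pi fun _ => isCompact_sphere _ _).image hcont).exists_isGreatest ?_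
  exact ⟨_, fun _ => EuclideanSpace.single 0 1, fun s _ => by simp, rfl⟩

end Compactness

/-! ### Scalar estimates -/

section Estimates

/-- Fourth roots give `a² b ≤ κ²`, and `b ≤ 1` gives `(ab)² ≤ a² b`. -/
lemma mul_le_of_pow_mul_pow_le {a b κ : ℝ} (_ha : 0 ≤ a) (hb : 0 ≤ b) (hb1 : b ≤ 1) (hκ : 0 ≤ κ)
    (h : a ^ 8 * b ^ 4 ≤ κ ^ 8) : a * b ≤ κ := by
  have h1 : a ^ 2 * b ≤ κ ^ 2 := by
    refine le_of_pow_le_pow_left₀ (n := 4) (by norm_num) (by positivity) ?_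
    calc (a ^ 2 * b) ^ 4 = a ^ 8 * b ^ 4 := by ring
      _ ≤ κ ^ 8 := h
      _ = (κ ^ 2) ^ 4 := by ring
  refine le_of_pow_le_pow_left₀ two_ne_zero hκ ?_
  have : a ^ 2 * b * b ≤ a ^ 2 * b * 1 := by gcongr
  nlinarith

/-- If `‖a‖ ‖b‖` is small, then `‖c a + s b‖²` is close to `c² ‖a‖² + s² ‖b‖²`. -/
lemma abs_norm_sq_sub_le {a b : ℂ} {c s C σ κ : ℝ} (ha : ‖a‖ ≤ 1) (hb : ‖b‖ ≤ 1)
    (hab : ‖a‖ * ‖b‖ ≤ κ) (hcs : s ^ 2 + c ^ 2 = 1) (hC : σ ^ 2 + C ^ 2 = 1) (hC0 : 0 < C)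
    (hσ0 : 0 ≤ σ) (hσ : σ ≤ κ) (hκ : κ ≤ 1 / 2) :
    |‖((c / C : ℝ) : ℂ) * a + ((s - c * σ / C : ℝ) : ℂ) * b‖ ^ 2
      - (c ^ 2 * ‖a‖ ^ 2 + s ^ 2 * ‖b‖ ^ 2)| ≤ 34 * κ := by
  have hc1 : |c| ≤ 1 := abs_le_one_iff_mul_self_le_one.2 (by nlinarith [sq_nonneg s])
  have hs1 : |s| ≤ 1 := abs_le_one_iff_mul_self_le_one.2 (by nlinarith [sq_nonneg c])
  have hC2 : 1 / 2 ≤ C := by nlinarith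
  have hC1 : C ≤ 1 := by nlinarith
  set z₀ : ℂ := (c : ℂ) * a + (s : ℂ) * b
  set z : ℂ := ((c / C : ℝ) : ℂ) * a + ((s - c * σ / C : ℝ) : ℂ) * b
  -- Replacing `C` by 1 and `σ` by 0 turns `z` into `z₀`. Both changes are of order `κ`, since `1 -
  -- C ≤ 1 - C² = σ²` and `C ≥ 1/2`.
  have hdiff : ‖z - z₀‖ ≤ 4 * κ := by
    have e : z - z₀ = ((c * (1 - C) / C : ℝ) : ℂ) * a - ((c * σ / C : ℝ) : ℂ) * b := by
      have : (C : ℂ) ≠ 0 := by exact_mod_cast hC0.ne'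
      simp only [z, z₀]; push_cast; field_simp; ring
    have h1 : |c * (1 - C) / C| ≤ 2 * κ := by
      rw [abs_div, abs_mul, abs_of_pos hC0, abs_of_nonneg (sub_nonneg.2 hC1), div_le_iff₀ hC0]
      have : |c| * (1 - C) ≤ 1 * (1 - C) := by gcongr
      nlinarith
    have h2 : |c * σ / C| ≤ 2 * κ := by
      rw [abs_div, abs_mul, abs_of_pos hC0, abs_of_nonneg hσ0, div_le_iff₀ hC0]
      have : |c| * σ ≤ 1 * σ := by gcongr
      nlinarith
    calc ‖z - z₀‖ ≤ |c * (1 - C) / C| * ‖a‖ + |c * σ / C| * ‖b‖ := by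
          rw [e]
          refine (norm_sub_le _ _).trans_eq ?_
          rw [norm_mul, norm_mul, Complex.norm_real, Complex.norm_real, Real.norm_eq_abs,
            Real.norm_eq_abs]
      _ ≤ 2 * κ * 1 + 2 * κ * 1 := by gcongr <;> linarith
      _ = 4 * κ := by ring
  have hz₀ : ‖z₀‖ ≤ 2 := by
    calc ‖z₀‖ ≤ |c| * ‖a‖ + |s| * ‖b‖ := by
          refine (norm_add_le _ _).trans_eq ?_
          rw [norm_mul, norm_mul, Complex.norm_real, Complex.norm_real, Real.norm_eq_abs,
            Real.norm_eq_abs]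
      _ ≤ 1 * 1 + 1 * 1 := by gcongr
      _ = 2 := by norm_num
  have hcross : |‖z₀‖ ^ 2 - (c ^ 2 * ‖a‖ ^ 2 + s ^ 2 * ‖b‖ ^ 2)| ≤ 2 * κ := by
    have h := norm_add_sq (𝕜 := ℂ) ((c : ℂ) * a) ((s : ℂ) * b)
    simp only [norm_mul, Complex.norm_real, Real.norm_eq_abs, mul_pow, sq_abs] at h
    have hre : |RCLike.re (inner ℂ ((c : ℂ) * a) ((s : ℂ) * b) : ℂ)| ≤ κ := by
      refine (RCLike.abs_re_le_norm _).trans ((norm_inner_le_norm _ _).trans ?_)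
      rw [norm_mul, norm_mul, Complex.norm_real, Complex.norm_real, Real.norm_eq_abs,
        Real.norm_eq_abs]
      calc |c| * ‖a‖ * (|s| * ‖b‖) = |c| * |s| * (‖a‖ * ‖b‖) := by ring
        _ ≤ 1 * 1 * (‖a‖ * ‖b‖) := by gcongr
        _ ≤ κ := by linarith
    rw [h, show ∀ x y w : ℝ, x + 2 * w + y - (x + y) = 2 * w by intros; ring, abs_mul, abs_two]
    linarith
  have hsq : |‖z‖ ^ 2 - ‖z₀‖ ^ 2| ≤ 32 * κ := by
    have h1 : |‖z‖ - ‖z₀‖| ≤ 4 * κ := (abs_norm_sub_norm_le z z₀).trans hdiff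
    have h2 : ‖z‖ + ‖z₀‖ ≤ 8 := by linarith [(abs_le.1 h1).2]
    rw [sq_sub_sq, abs_mul, abs_of_nonneg (by positivity : 0 ≤ ‖z‖ + ‖z₀‖)]
    nlinarith [abs_nonneg (‖z‖ - ‖z₀‖), norm_nonneg z, norm_nonneg z₀]
  have := abs_sub_le (‖z‖ ^ 2) (‖z₀‖ ^ 2) (c ^ 2 * ‖a‖ ^ 2 + s ^ 2 * ‖b‖ ^ 2)
  linarith

/-- Writing `b² = b² (1 - a²) + (ab)²` makes the left side at most a convex combination, with
weights `a²` and `1 - a²`, of quantities below the maximum, plus `s² (ab)²`. -/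
lemma convex_combination_le_max {a b c s B κ : ℝ} (ha : 0 ≤ a) (ha1 : a ≤ 1) (hb : 0 ≤ b)
    (hbB : b ≤ B) (hab : a * b ≤ κ) (hs : s ^ 2 ≤ 1) :
    c ^ 2 * a ^ 2 + s ^ 2 * b ^ 2 ≤ max (c ^ 2) (s ^ 2 * B ^ 2) + κ ^ 2 := by
  have ha2 : a ^ 2 ≤ 1 := pow_le_one₀ ha ha1
  have h1 : c ^ 2 * a ^ 2 ≤ max (c ^ 2) (s ^ 2 * B ^ 2) * a ^ 2 := by
    gcongr; exact le_max_left _ _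
  have h2 : s ^ 2 * b ^ 2 * (1 - a ^ 2) ≤ max (c ^ 2) (s ^ 2 * B ^ 2) * (1 - a ^ 2) := by
    refine mul_le_mul_of_nonneg_right (le_trans ?_ (le_max_right _ _)) (by linarith)
    gcongr
  have h3 : s ^ 2 * (a * b) ^ 2 ≤ 1 * κ ^ 2 := by gcongr
  nlinarith

end Estimates

end GroverGME

/-! ### The approximation of the maximal overlap -/

theorem lemma1 :
    ∀ ε : ℝ, 0 < ε → ∃ δ : ℝ, 0 < δ ∧
      ∀ (n k : ℕ) (S : Finset (Fin n → Fin 2)), S.Nonempty →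
        GroverGME.IsSymmetricState (GroverGME.markedState S) →
        (S.card : ℝ) ≤ δ * (2 : ℝ) ^ n →
        ∃ m Bmax : ℝ,
          IsGreatest (GroverGME.squaredOverlaps (GroverGME.groverState S k)) m ∧
          IsGreatest (GroverGME.overlapB S '' Set.Icc 0 Real.pi) Bmax ∧
          |m - max (Real.cos (GroverGME.groverAngle S k) ^ 2)
              (Real.sin (GroverGME.groverAngle S k) ^ 2 * Bmax ^ 2)| ≤ ε := by
  open GroverGME in
  intro ε hε
  -- The total error is at most `34κ + κ² ≤ 35κ`. The choice `δ = κ⁸` matches `a⁸ b⁴ ≤ M/N`.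
  set κ := min (1 / 2) (ε / 35)
  have hκ0 : 0 < κ := lt_min (by norm_num) (by positivity)
  have hκ2 : κ ≤ 1 / 2 := min_le_left _ _
  have hκε : 35 * κ ≤ ε := by linarith [min_le_right (1 / 2) (ε / 35)]
  refine ⟨κ ^ 8, by positivity, fun n k S hne hS hM => ?_⟩
  have hMN : (S.card : ℝ) / 2 ^ n ≤ κ ^ 8 := (div_le_iff₀ (by positivity)).2 hM
  have hκ8 : κ ^ 8 < 1 := pow_lt_one₀ hκ0.le (by linarith) (by norm_num)
  have hlt : (S.card : ℝ) < 2 ^ n := (div_lt_one (by positivity)).1 (hMN.trans_lt hκ8)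
  obtain ⟨m, hm⟩ := exists_isGreatest_squaredOverlaps (groverState S k)
  obtain ⟨B, hB⟩ := exists_isGreatest_overlapB S
  refine ⟨m, B, hm, hB, ?_⟩
  set c := Real.cos (groverAngle S k)
  set s := Real.sin (groverAngle S k)
  have hcs : s ^ 2 + c ^ 2 = 1 := Real.sin_sq_add_cos_sq _
  have hσκ : √((S.card : ℝ) / 2 ^ n) ≤ κ := by
    refine Real.sqrt_le_iff.2 ⟨hκ0.le, hMN.trans ?_⟩
    exact pow_le_pow_of_le_one hκ0.le (by linarith) (by norm_num)
  have hσ0 : 0 ≤ √((S.card : ℝ) / 2 ^ n) := Real.sqrt_nonneg _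
  have hsin : Real.sin (Real.arcsin √((S.card : ℝ) / 2 ^ n)) = √((S.card : ℝ) / 2 ^ n) :=
    Real.sin_arcsin (by linarith) (by linarith)
  have hcos : 0 < Real.cos (Real.arcsin √((S.card : ℝ) / 2 ^ n)) := by
    rw [Real.cos_arcsin]; apply Real.sqrt_pos.2; nlinarith
  have hC := Real.sin_sq_add_cos_sq (Real.arcsin √((S.card : ℝ) / 2 ^ n))
  rw [hsin] at hC
  have happrox : ∀ v : Fin n → EuclideanSpace ℂ (Fin 2), (∀ s, ‖v s‖ = 1) →
      ‖(inner ℂ (uniformState n) (tensorState v) : ℂ)‖ ≤ 1 ∧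
      ‖(inner ℂ (uniformState n) (tensorState v) : ℂ)‖ *
        ‖(inner ℂ (markedState S) (tensorState v) : ℂ)‖ ≤ κ ∧
      |‖(inner ℂ (groverState S k) (tensorState v) : ℂ)‖ ^ 2 -
        (c ^ 2 * ‖(inner ℂ (uniformState n) (tensorState v) : ℂ)‖ ^ 2 +
          s ^ 2 * ‖(inner ℂ (markedState S) (tensorState v) : ℂ)‖ ^ 2)| ≤ 34 * κ := by
    intro v hv
    have ha : ‖(inner ℂ (uniformState n) (tensorState v) : ℂ)‖ ≤ 1 := by
      rw [uniformState_eq_markedState]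
      exact norm_inner_markedState_le_one Finset.univ_nonempty hv
    have hb := norm_inner_markedState_le_one hne hv
    have hab := mul_le_of_pow_mul_pow_le (norm_nonneg _) (norm_nonneg _) hb hκ0.le
      ((norm_inner_uniformState_pow_mul_le hne hv).trans hMN)
    refine ⟨ha, hab, ?_⟩
    rw [groverState_eq hlt, inner_add_left, inner_smul_left, inner_smul_left, Complex.conj_ofReal,
      Complex.conj_ofReal]
    exact abs_norm_sq_sub_le ha hb hab hcs hC hcos hσ0 hσκ hκ2
  have hs1 : s ^ 2 ≤ 1 := by nlinarith [sq_nonneg c]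
  rw [abs_sub_le_iff]
  constructor
  · obtain ⟨φ, ⟨v, hv, rfl⟩, rfl⟩ := hm.1
    obtain ⟨ha, hab, h⟩ := happrox v hv
    have := convex_combination_le_max (c := c) (norm_nonneg _) ha (norm_nonneg _)
      (norm_inner_markedState_le hne hS hB.2 hv) hab hs1
    nlinarith [(abs_le.1 h).2]
  · rw [sub_le_iff_le_add]
    apply max_le
    -- For the lower bounds, one test state per extreme suffices: the term with the other overlap is
    -- nonnegative and can be dropped.
    · obtain ⟨v, hv, h1⟩ := exists_inner_uniformState_eq_one n
      obtain ⟨-, -, h⟩ := happrox v hv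
      have hle := hm.2 ⟨_, ⟨v, hv, rfl⟩, rfl⟩
      rw [h1] at h
      nlinarith [(abs_le.1 h).1, mul_nonneg (sq_nonneg s)
        (sq_nonneg ‖(inner ℂ (markedState S) (tensorState v) : ℂ)‖)]
    · obtain ⟨α, -, hα⟩ := hB.1
      obtain ⟨v, hv, h1⟩ := exists_inner_markedState_eq_overlapB S α
      obtain ⟨-, -, h⟩ := happrox v hv
      have hle := hm.2 ⟨_, ⟨v, hv, rfl⟩, rfl⟩
      rw [h1, sq_abs, hα] at h
      nlinarith [(abs_le.1 h).1, mul_nonneg (sq_nonneg c)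
        (sq_nonneg ‖(inner ℂ (uniformState n) (tensorState v) : ℂ)‖)]
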